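/- **Setting.** Let $\mathcal X$ be a measurable space of features, $\mathcal Y$ a finite set of labels and $\tilde{\mathcal Y}$ a finite set of noisy observations, each with at least two elements, and let $\mathcal D(\tilde{\mathcal Y})$ be the set of probability distributions on $\tilde{\mathcal Y}$. A *noisy kernel* $\mathcal K$ assigns to each $(x,y)\in\mathcal X\times\mathcal Y$ a set $\mathcal Q_y^x\subset\mathcal D(\tilde{\mathcal Y})$, here always closed and convex. It is *well-separated at scale $\gamma_H>0$ w.r.t. the (squared) Hellinger divergence* $H^2(p,q)=\sum_{\tilde y}(\sqrt{p[\tilde y]}-\sqrt{q[\tilde y]})^2$ if $\inf_{p\in\mathcal Q_y^x,\,q\in\mathcal Q_{y'}^x}H^2(p,q)\ge\gamma_H$ for all $x\in\mathcal X$ and all $y\ne y'$ in $\mathcal Y$. Let $T\in\mathbb N$ and write $x^t=(x_1,\dots,x_t)$. Let $\mathcal H\subset\mathcal Y^{\mathcal X}$ be a hypothesis class and $\mathsf P$ a class of random processes over $\mathcal X^T$ (probability measures on $\mathcal X^T$). A class $\mathcal G\subset\mathcal Y^{\mathcal X^*}$ of functions on finite sequences is a *stochastic sequential cover* of $\mathcal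 H$ w.r.t. $\mathsf P$ at scale $0$ and confidence $\delta'$ if for all $\nu\in\mathsf P$ $$\Pr_{x^T\sim\nu}\big[\exists h\in\mathcal H\ \forall g\in\mathcal G\ \exists t\le T:\ h(x_t)\ne g(x^t)\big]\le\delta'.$$ A *predictor* $\Phi$ maps $(x^t,\tilde y^{t-1})$ to a distribution on $\mathcal Y$. The game for $\nu\in\mathsf P$, a ground truth $h\in\mathcal H$ and an adversary: the features $x^T$ are drawn from $\nu$; at each time $t\le T$ the prediction $\hat y_t$ is drawn from $\Phi(x^t,\tilde y^{t-1})$, with internal randomness independent over time, and the noisy label $\tilde y_t$ is drawn from a distribution $\tilde p_t\in\mathcal Q_{h(x_t)}^{x_t}$ that the adversary may choose as an arbitrary function of $x^T$ and $\tilde y^{t-1}$ (obliviously to the predictions). The *risk* is $\sum_{t=1}^T 1\{h(x_t)\ne\hat y_t\}$. **Theorem.** There is an absolute constant $C>0$ such that the following holds for all $\mathcal X,\mathcal Y,\tilde{\mathcal Y},T,\mathcal H,\mathsf P$ as above, every closed- and convex-valued noisy kernel $\mathcal K$ that is well-separated at scale $\gamma_H>0$ w.r.t. the squared Hellinger divergence,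 and every $\delta>0$. If $\mathcal G$ is a finite stochastic sequential cover of $\mathcal H$ w.r.t. $\mathsf P$ at scale $0$ and confidence $\delta/2$, then there is a predictor $\Phi$ such that for every $\nu\in\mathsf P$, every $h\in\mathcal H$ and every adversary, with probability at least $1-\delta$ over all the randomness involved ($x^T$, $\tilde y^T$ and $\hat y^T$), $$\sum_{t=1}^T 1\{h(x_t)\ne\hat y_t\}\ \le\ C\,\frac{\log|\mathcal G|\,\log(4|\mathcal G|/\delta)}{\gamma_H}.$$ -/

import Mathlib

open MeasureTheory

namespace NoisyOnline

/-- A noisy kernel: each pair (feature, true label) is sent to a set of probability distributions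
over the finite set `Z` of noisy observations. -/
structure NoisyKernel (X Y Z : Type*) [Fintype Z] where
  /-- the set `Q_y^x` of allowed noisy label distributions -/
  dists : X → Y → Set (Z → ℝ)
  subset_stdSimplex : ∀ x y, dists x y ⊆ stdSimplex ℝ Z

/-- The squared Hellinger divergence `∑ z, (√p[z] - √q[z])²`. -/
noncomputable def hellingerSq {Z : Type*} [Fintype Z] (p q : Z → ℝ) : ℝ :=
  ∑ z, (Real.sqrt (p z) - Real.sqrt (q z)) ^ 2

/-- The divergence of two sets of distributions, `inf_{p ∈ P, q ∈ Q} L p q`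
(with value `⊤` when one of the sets is empty). -/
noncomputable def setDivergence {Z : Type*} (L : (Z → ℝ) → (Z → ℝ) → ℝ)
    (P Q : Set (Z → ℝ)) : EReal :=
  ⨅ p ∈ P, ⨅ q ∈ Q, (L p q : EReal)

/-- `K` is well-separated with respect to the divergence `L` at scale `γ > 0`. -/
def NoisyKernel.WellSeparated {X Y Z : Type*} [Fintype Z] (K : NoisyKernel X Y Z)
    (L : (Z → ℝ) → (Z → ℝ) → ℝ) (γ : ℝ) : Prop :=
  0 < γ ∧ ∀ (x : X) (y y' : Y), y ≠ y' →
    (γ : EReal) ≤ setDivergence L (K.dists x y) (K.dists x y')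

/-- The list of the first `n` entries of a sequence of length `T`. -/
def hist {α : Type*} {T : ℕ} (v : Fin T → α) (n : ℕ) : List α := (List.ofFn v).take n

/-- `G ⊆ Y^{X^*}` is a stochastic sequential covering of `H` with respect to the class `P` of
random processes over `X^T`, at scale `0` and confidence `δ`. -/
def IsStochasticSequentialCover {X Y : Type*} [MeasurableSpace X] {T : ℕ}
    (H : Set (X → Y)) (P : Set (ProbabilityMeasure (Fin T → X)))
    (G : Set (List X → Y)) (δ : ℝ) : Prop :=
  ∀ ν ∈ P, (ν : Measure (Fin T → X))
    {x | ∃ h ∈ H, ∀ g ∈ G, ∃ t : Fin T, h (x t) ≠ g (hist x (t + 1))} ≤ ENNReal.ofReal δ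

/-- A (randomized) predictor: from the features `x_1, …, x_t` and the noisy labels
`z_1, …, z_{t-1}` it produces the distribution of the prediction at time `t`. -/
structure Predictor (X Y Z : Type*) [Fintype Y] where
  dist : List X → List Z → (Y → ℝ)
  mem_stdSimplex : ∀ xs zs, dist xs zs ∈ stdSimplex ℝ Y

/-- An adversary for a fixed feature sequence `x`: after noisy labels `z_1, …, z_{t-1}` it uses
the distribution `p [z_1, …, z_{t-1}]` for the noisy label `z_t`. It is admissible for the ground
truth `h` if this distribution always lies in the kernel set of `(x_t, h x_t)`.
(Times are numbered from `0`, so the history before time `t` has length `t`.) -/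
def NoisyKernel.Admissible {X Y Z : Type*} [Fintype Z] (K : NoisyKernel X Y Z) (h : X → Y)
    {T : ℕ} (x : Fin T → X) (p : List Z → (Z → ℝ)) : Prop :=
  ∀ (t : Fin T) (zs : List Z), zs.length = t → p zs ∈ K.dists (x t) (h (x t))

/-- For the feature sequence `x`, the probability that the noisy labels are `z` and the
predictions are `yhat`: each `z_t` is drawn from `p (z_1, …, z_{t-1})`, each `yhat_t` from
`Φ (x_1, …, x_t; z_1, …, z_{t-1})`. -/
def pathProb {X Y Z : Type*} [Fintype Y] {T : ℕ} (Φ : Predictor X Y Z)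
    (p : List Z → (Z → ℝ)) (x : Fin T → X) (z : Fin T → Z) (yhat : Fin T → Y) : ℝ :=
  (∏ t : Fin T, p (hist z t) (z t)) *
    ∏ t : Fin T, Φ.dist (hist x (t + 1)) (hist z t) (yhat t)

open Classical in
/-- The risk (cumulative error): the number of wrong predictions. -/
noncomputable def risk {X Y : Type*} {T : ℕ} (h : X → Y) (x : Fin T → X) (yhat : Fin T → Y) : ℕ :=
  ∑ t : Fin T, if h (x t) ≠ yhat t then 1 else 0

open Classical in
/-- For the feature sequence `x`, the probability (over the noisy labels and the internal
randomness of the predictor) that the risk is at most `B`. -/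
noncomputable def probRiskLE {X Y Z : Type*} [Fintype Y] [Fintype Z] {T : ℕ}
    (Φ : Predictor X Y Z) (h : X → Y) (p : List Z → (Z → ℝ)) (B : ℝ) (x : Fin T → X) : ℝ :=
  ∑ z : Fin T → Z, ∑ yhat : Fin T → Y,
    if (risk h x yhat : ℝ) ≤ B then pathProb Φ p x z yhat else 0

end NoisyOnline

namespace NoisyOnline
open Finset

/-! Fix a feature sequence on which the ground truth agrees with some `g ∈ G`, so that `G` is a
finite set of experts. For two labels, convexity and compactness give a pair of positive tests `φ,
φ'`, each of mean at most 1 under every distribution of its own label, whose product is the constant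
`exp (γ / 2)` (`exists_affinity_test`, `exists_test`). Products of tests along the observations are
then supermartingales under the respective true expert.

An expert is eliminated once its evidence against some rival exceeds `A = 4|G|/δ`. By the maximal
inequality `sum_obsProb_evidence_le` and a union bound, with probability at least `1 - δ/2` no test
misleads about `g`. Then `g` survives, and each survivor `i` has both of its evidences against `g`
at most `A`; their product is `exp (γ / 2)` to the number of disagreements, which is therefore at
most `4 log A / γ`.

The predictor is a plurality vote of the survivors. Each mistake means that at least half of them
disagree with `g`, and each has a bounded budget of disagreements, so a multiplicative potential
bounds the mistakes by `log |G|` times the budget (`card_filter_le_of_elimination`). The other `δ/2`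
pays for the failure of the cover. -/

/-! ### Tests separating two convex sets of distributions. -/

theorem hellingerSq_eq {Z : Type*} [Fintype Z] {p q : Z → ℝ} (hp : p ∈ stdSimplex ℝ Z)
    (hq : q ∈ stdSimplex ℝ Z) :
    hellingerSq p q = 2 - 2 * ∑ z, Real.sqrt (p z) * Real.sqrt (q z) := by
  have h : ∀ z, (Real.sqrt (p z) - Real.sqrt (q z)) ^ 2
      = p z + q z - 2 * (Real.sqrt (p z) * Real.sqrt (q z)) := fun z => by
    rw [sub_sq, Real.sq_sqrt (hp.1 z), Real.sq_sqrt (hq.1 z)]; ring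
  simp only [hellingerSq, h, sum_sub_distrib, sum_add_distrib, hp.2, hq.2, ← mul_sum]
  ring

theorem hellingerSq_le_two {Z : Type*} [Fintype Z] {p q : Z → ℝ} (hp : p ∈ stdSimplex ℝ Z)
    (hq : q ∈ stdSimplex ℝ Z) : hellingerSq p q ≤ 2 := by
  rw [hellingerSq_eq hp hq]
  have : 0 ≤ ∑ z, Real.sqrt (p z) * Real.sqrt (q z) := sum_nonneg fun z _ => by positivity
  linarith

/-- First-order condition for maximising the smoothed affinity `∑ √((p + ε) b)` in `p`. -/
theorem sum_mul_sqrt_div_le_of_isMaxOn {Z : Type*} [Fintype Z] {P : Set (Z → ℝ)}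
    (hP : Convex ℝ P) (hpos : ∀ p ∈ P, ∀ z, 0 ≤ p z) {ε : ℝ} (hε : 0 < ε) {b : Z → ℝ}
    {a : Z → ℝ} (ha : a ∈ P)
    (hmax : IsMaxOn (fun p : Z → ℝ => ∑ z, Real.sqrt (p z + ε) * Real.sqrt (b z)) P a)
    {p : Z → ℝ} (hp : p ∈ P) :
    ∑ z, p z * (Real.sqrt (b z) / Real.sqrt (a z + ε))
      ≤ ∑ z, Real.sqrt (a z + ε) * Real.sqrt (b z) := by
  have hpa : ∀ z, 0 < a z + ε := fun z => by linarith [hpos a ha z]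
  -- The objective on the segment from `a` towards `p`. Its derivative at 0 cannot be positive; `ε >
  -- 0` makes it exist even where `a` vanishes.
  let F : ℝ → ℝ := fun s => ∑ z, Real.sqrt (a z + s * (p z - a z) + ε) * Real.sqrt (b z)
  have hF : HasDerivAt F
      (∑ z, (p z - a z) / (2 * Real.sqrt (a z + ε)) * Real.sqrt (b z)) 0 := by
    refine HasDerivAt.fun_sum fun z _ => HasDerivAt.mul_const ?_ _
    have h1 : HasDerivAt (fun s : ℝ => a z + s * (p z - a z) + ε) (p z - a z) 0 := by
      simpa using (((hasDerivAt_id (0 : ℝ)).mul_const (p z - a z)).const_add (a z)).add_const ε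
    simpa using h1.sqrt (by simpa using (hpa z).ne')
  have hle : ∑ z, (p z - a z) / (2 * Real.sqrt (a z + ε)) * Real.sqrt (b z) ≤ 0 := by
    by_contra! hcon
    have hev := (hasDerivAt_iff_tendsto_slope_zero.1 hF).eventually (lt_mem_nhds hcon)
    have h2 := (nhdsWithin_mono (0 : ℝ) (show Set.Ioi (0 : ℝ) ⊆ {0}ᶜ from
      fun s hs => ne_of_gt hs)) hev
    have h3 : ∀ᶠ s : ℝ in nhdsWithin 0 (Set.Ioi 0), s ∈ Set.Ioo (0 : ℝ) 1 :=
      Ioo_mem_nhdsGT one_pos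
    obtain ⟨s, hs, hs01⟩ := (Filter.Eventually.and h2 h3).exists
    have hmem : (fun z => a z + s * (p z - a z)) ∈ P := by
      convert hP ha hp (sub_nonneg.2 hs01.2.le) hs01.1.le (by ring) using 1
      ext z; simp; ring
    have hm := hmax hmem
    have hsF : F s ≤ F 0 := by simpa [F] using hm
    simp only [zero_add, smul_eq_mul] at hs
    have := mul_pos hs01.1 hs
    rw [mul_inv_cancel_left₀ hs01.1.ne'] at this
    linarith
  -- With `w = √b / √(a + ε)`, this is `p w ≤ (p - a) w + (a + ε) w`; the slack is `ε w`.
  have key : ∀ z, p z * (Real.sqrt (b z) / Real.sqrt (a z + ε))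
      ≤ 2 * ((p z - a z) / (2 * Real.sqrt (a z + ε)) * Real.sqrt (b z))
        + Real.sqrt (a z + ε) * Real.sqrt (b z) := fun z => by
    have hs : 0 < Real.sqrt (a z + ε) := Real.sqrt_pos.2 (hpa z)
    have e : Real.sqrt (a z + ε) * Real.sqrt (b z)
        = (a z + ε) * (Real.sqrt (b z) / Real.sqrt (a z + ε)) := by
      nth_rewrite 2 [← Real.sq_sqrt (hpa z).le]
      field_simp
    have e2 : 2 * ((p z - a z) / (2 * Real.sqrt (a z + ε)) * Real.sqrt (b z))
        = (p z - a z) * (Real.sqrt (b z) / Real.sqrt (a z + ε)) := by field_simp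
    rw [e, e2]
    have : 0 ≤ ε * (Real.sqrt (b z) / Real.sqrt (a z + ε)) := by positivity
    nlinarith
  calc _ ≤ _ := sum_le_sum fun z _ => key z
    _ ≤ _ := by rw [sum_add_distrib, ← mul_sum]; linarith

theorem sqrt_add_mul_sqrt_add_le {a b r : ℝ} (ha : a ∈ Set.Icc (0 : ℝ) 1)
    (hb : b ∈ Set.Icc (0 : ℝ) 1) (hr : r ∈ Set.Icc (0 : ℝ) 1) :
    Real.sqrt (a + r ^ 2) * Real.sqrt (b + r ^ 2) ≤ Real.sqrt a * Real.sqrt b + 3 * r := by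
  have h1 : ∀ {c : ℝ}, 0 ≤ c → Real.sqrt (c + r ^ 2) ≤ Real.sqrt c + r := fun {c} hc => by
    refine Real.sqrt_le_iff.2 ⟨add_nonneg (Real.sqrt_nonneg _) hr.1, ?_⟩
    nlinarith [Real.sq_sqrt hc, mul_nonneg (Real.sqrt_nonneg c) hr.1]
  have h2 : ∀ {c : ℝ}, c ≤ 1 → Real.sqrt c ≤ 1 := fun {c} hc => by
    simpa using Real.sqrt_le_sqrt hc
  have h3 := mul_le_mul (h1 ha.1) (h1 hb.1) (Real.sqrt_nonneg _)
    (add_nonneg (Real.sqrt_nonneg _) hr.1)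
  nlinarith [mul_le_mul_of_nonneg_right (h2 ha.2) hr.1, mul_le_mul_of_nonneg_right (h2 hb.2) hr.1,
    mul_le_mul_of_nonneg_right hr.2 hr.1]

/-- Two nonempty closed convex sets of distributions at squared Hellinger distance at least `γ` are
distinguished by a likelihood-ratio-like function. -/
theorem exists_affinity_test {Z : Type*} [Fintype Z] {P Q : Set (Z → ℝ)} {γ : ℝ} (hγ : 0 < γ)
    (hPs : P ⊆ stdSimplex ℝ Z) (hQs : Q ⊆ stdSimplex ℝ Z) (hPc : Convex ℝ P) (hQc : Convex ℝ Q)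
    (hPcl : IsClosed P) (hQcl : IsClosed Q) (hPn : P.Nonempty) (hQn : Q.Nonempty)
    (hsep : ∀ p ∈ P, ∀ q ∈ Q, γ ≤ hellingerSq p q) :
    ∃ ψ : Z → ℝ, (∀ z, 0 < ψ z) ∧ (∀ p ∈ P, ∑ z, p z * ψ z ≤ 1 - γ / 4) ∧
      ∀ q ∈ Q, ∑ z, q z * (ψ z)⁻¹ ≤ 1 - γ / 4 := by
  set n : ℝ := (Fintype.card Z : ℝ) with hn
  -- Separation bounds the affinity by `1 - γ/2`. Smoothing by `r ^ 2` costs at most `3 r` per point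
  -- of `Z`, and this `r` keeps the total cost below `γ/4`.
  set r : ℝ := min 1 (γ / (12 * (n + 1))) with hr
  have hn0 : 0 ≤ n := Nat.cast_nonneg _
  have hr0 : 0 < r := lt_min one_pos (by positivity)
  have hrn : n * (3 * r) ≤ γ / 4 := by
    have h1 : r * (12 * (n + 1)) ≤ γ := (le_div_iff₀ (by positivity)).1 (min_le_right _ _)
    nlinarith
  have hPQ : IsCompact (P ×ˢ Q) :=
    ((isCompact_stdSimplex ℝ Z).of_isClosed_subset hPcl hPs).prod
      ((isCompact_stdSimplex ℝ Z).of_isClosed_subset hQcl hQs)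
  obtain ⟨⟨a, b⟩, ⟨ha, hb⟩, hmax⟩ := hPQ.exists_isMaxOn (hPn.prod hQn)
    (f := fun pq : (Z → ℝ) × (Z → ℝ) =>
      ∑ z, Real.sqrt (pq.1 z + r ^ 2) * Real.sqrt (pq.2 z + r ^ 2))
    (by fun_prop)
  simp only at ha hb
  have hr2 : 0 < r ^ 2 := by positivity
  have hap : ∀ z, 0 < a z + r ^ 2 := fun z => by linarith [(hPs ha).1 z]
  have hbp : ∀ z, 0 < b z + r ^ 2 := fun z => by linarith [(hQs hb).1 z]
  have hval : ∑ z, Real.sqrt (a z + r ^ 2) * Real.sqrt (b z + r ^ 2) ≤ 1 - γ / 4 := by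
    have h1 : ∑ z, Real.sqrt (a z + r ^ 2) * Real.sqrt (b z + r ^ 2)
        ≤ ∑ z, (Real.sqrt (a z) * Real.sqrt (b z) + 3 * r) :=
      sum_le_sum fun z _ => sqrt_add_mul_sqrt_add_le
        (mem_Icc_of_mem_stdSimplex (hPs ha) z) (mem_Icc_of_mem_stdSimplex (hQs hb) z)
        ⟨hr0.le, min_le_left _ _⟩
    rw [sum_add_distrib, sum_const, card_univ, nsmul_eq_mul] at h1
    have h2 := hsep a ha b hb
    rw [hellingerSq_eq (hPs ha) (hQs hb)] at h2
    linarith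
  -- The square root of the likelihood ratio of the smoothed pair of maximal affinity. Inversion
  -- swaps the roles of `P` and `Q`, so one first-order condition serves both sides.
  refine ⟨fun z => Real.sqrt (b z + r ^ 2) / Real.sqrt (a z + r ^ 2),
    fun z => div_pos (Real.sqrt_pos.2 (hbp z)) (Real.sqrt_pos.2 (hap z)),
    fun p hp => le_trans ?_ hval, fun q hq => le_trans ?_ hval⟩
  · exact sum_mul_sqrt_div_le_of_isMaxOn (b := fun z => b z + r ^ 2) hPc (fun p hp => (hPs hp).1) hr2 ha
      (fun p hp => hmax (show (p, b) ∈ P ×ˢ Q from ⟨hp, hb⟩)) hp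
  · simp only [inv_div, mul_comm (Real.sqrt (a _ + r ^ 2)) (Real.sqrt (b _ + r ^ 2))]
    refine sum_mul_sqrt_div_le_of_isMaxOn (b := fun z => a z + r ^ 2) hQc (fun p hp => (hQs hp).1) hr2 hb
      (fun q hq => ?_) hq
    have := hmax (show (a, q) ∈ P ×ˢ Q from ⟨ha, hq⟩)
    simpa only [Set.mem_ofPred_eq, mul_comm (Real.sqrt (a _ + r ^ 2))] using this

theorem NoisyKernel.WellSeparated.le_of_mem {X Y Z : Type*} [Fintype Z] {K : NoisyKernel X Y Z}
    {L : (Z → ℝ) → (Z → ℝ) → ℝ} {γ : ℝ} (hK : K.WellSeparated L γ) {x : X} {y y' : Y}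
    (hy : y ≠ y') {p q : Z → ℝ} (hp : p ∈ K.dists x y) (hq : q ∈ K.dists x y') : γ ≤ L p q :=
  EReal.coe_le_coe_iff.1 ((hK.2 x y y' hy).trans ((iInf₂_le p hp).trans (iInf₂_le q hq)))

-- The affinity test and its inverse are each scaled by `exp (γ / 4)`; the means stay at most 1
-- because `1 - γ/4 ≤ exp (-γ/4)`.
open Classical in
theorem NoisyKernel.WellSeparated.exists_test {X Y Z : Type*} [Fintype Z] {K : NoisyKernel X Y Z}
    {γ : ℝ} (hK : K.WellSeparated hellingerSq γ) (hc : ∀ x y, Convex ℝ (K.dists x y))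
    (hcl : ∀ x y, IsClosed (K.dists x y)) (x : X) (y y' : Y) :
    ∃ φ φ' : Z → ℝ, (∀ z, 0 < φ z) ∧ (∀ z, 0 < φ' z) ∧
      (∀ p ∈ K.dists x y, ∑ z, p z * φ z ≤ 1) ∧ (∀ p ∈ K.dists x y', ∑ z, p z * φ' z ≤ 1) ∧
      ∀ z, φ z * φ' z = if y = y' then 1 else Real.exp (γ / 2) := by
  by_cases hy : y = y'
  · subst hy
    exact ⟨fun _ => 1, fun _ => 1, by simp, by simp,
      fun p hp => by simp [(K.subset_stdSimplex x y hp).2],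
      fun p hp => by simp [(K.subset_stdSimplex x y hp).2], by simp⟩
  simp only [if_neg hy]
  have hγ := hK.1
  have hexp : Real.exp (γ / 2) = Real.exp (γ / 4) * Real.exp (γ / 4) := by
    rw [← Real.exp_add]; ring_nf
  -- An empty set constrains nothing, so its test can carry the whole factor `exp (γ / 2)`.
  by_cases hP : (K.dists x y).Nonempty
  swap
  · rw [Set.not_nonempty_iff_eq_empty] at hP
    exact ⟨fun _ => Real.exp (γ / 2), fun _ => 1, fun _ => Real.exp_pos _, by simp,
      by simp [hP], fun p hp => by simp [(K.subset_stdSimplex x y' hp).2], by simp⟩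
  by_cases hQ : (K.dists x y').Nonempty
  swap
  · rw [Set.not_nonempty_iff_eq_empty] at hQ
    exact ⟨fun _ => 1, fun _ => Real.exp (γ / 2), by simp, fun _ => Real.exp_pos _,
      fun p hp => by simp [(K.subset_stdSimplex x y hp).2], by simp [hQ], by simp⟩
  obtain ⟨ψ, hψ, h1, h2⟩ := exists_affinity_test hγ (K.subset_stdSimplex x y)
    (K.subset_stdSimplex x y') (hc x y) (hc x y') (hcl x y) (hcl x y') hP hQ
    fun p hp q hq => hK.le_of_mem hy hp hq
  have hle : Real.exp (γ / 4) * (1 - γ / 4) ≤ 1 := by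
    have := mul_le_mul_of_nonneg_left (Real.one_sub_le_exp_neg (γ / 4)) (Real.exp_pos (γ / 4)).le
    rwa [← Real.exp_add, add_neg_cancel, Real.exp_zero] at this
  refine ⟨fun z => Real.exp (γ / 4) * ψ z, fun z => Real.exp (γ / 4) * (ψ z)⁻¹,
    fun z => mul_pos (Real.exp_pos _) (hψ z), fun z => mul_pos (Real.exp_pos _) (inv_pos.2 (hψ z)),
    fun p hp => ?_, fun p hp => ?_, fun z => ?_⟩
  · simp only [mul_left_comm (p _), ← mul_sum]
    exact (mul_le_mul_of_nonneg_left (h1 p hp) (Real.exp_pos _).le).trans hle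
  · simp only [mul_left_comm (p _), ← mul_sum]
    exact (mul_le_mul_of_nonneg_left (h2 p hp) (Real.exp_pos _).le).trans hle
  · have := (hψ z).ne'
    rw [hexp]; field_simp

/-! ### Observation sequences and the maximal inequality for evidence. -/

theorem length_hist {α : Type*} {T : ℕ} (v : Fin T → α) {n : ℕ} (hn : n ≤ T) :
    (hist v n).length = n := by simp [hist, hn]

theorem hist_cons_succ {α : Type*} {T : ℕ} (a : α) (v : Fin T → α) (n : ℕ) :
    hist (Fin.cons a v : Fin (T + 1) → α) (n + 1) = a :: hist v n := by
  simp [hist, List.ofFn_succ]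

/-- The probability of the observation sequence `z` when each `z_t` has distribution
`p (z_1, …, z_{t-1})`. -/
def obsProb {Z : Type*} {T : ℕ} (p : List Z → Z → ℝ) (z : Fin T → Z) : ℝ :=
  ∏ t : Fin T, p (hist z t) (z t)

theorem obsProb_cons {Z : Type*} {T : ℕ} (p : List Z → Z → ℝ) (a : Z) (z : Fin T → Z) :
    obsProb p (Fin.cons a z : Fin (T + 1) → Z) = p [] a * obsProb (fun l => p (a :: l)) z := by
  simp only [obsProb, Fin.prod_univ_succ, Fin.cons_zero, Fin.cons_succ, Fin.val_succ,
    hist_cons_succ]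
  simp [hist]

theorem sum_fin_cons {Z : Type*} [Fintype Z] {T : ℕ} (f : (Fin (T + 1) → Z) → ℝ) :
    ∑ z, f z = ∑ a, ∑ z : Fin T → Z, f (Fin.cons a z) := by
  rw [← Fintype.sum_prod_type' (f := fun a z => f (Fin.cons a z))]
  exact (Equiv.sum_comp (Fin.consEquiv fun _ : Fin (T + 1) => Z) f).symm

theorem obsProb_nonneg {Z : Type*} [Fintype Z] {T : ℕ} {p : List Z → Z → ℝ}
    (hp : ∀ zs : List Z, zs.length < T → p zs ∈ stdSimplex ℝ Z) (z : Fin T → Z) :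
    0 ≤ obsProb p z :=
  prod_nonneg fun t _ => (hp _ (by rw [length_hist z t.2.le]; exact t.2)).1 _

theorem sum_obsProb {Z : Type*} [Fintype Z] {T : ℕ} {p : List Z → Z → ℝ}
    (hp : ∀ zs : List Z, zs.length < T → p zs ∈ stdSimplex ℝ Z) :
    ∑ z : Fin T → Z, obsProb p z = 1 := by
  induction T generalizing p with
  | zero => simp [obsProb]
  | succ T ih =>
    have h : ∀ a, ∑ z : Fin T → Z, obsProb (fun l => p (a :: l)) z = 1 := fun a =>
      ih fun zs hzs => hp _ (by simpa using hzs)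
    simp only [sum_fin_cons, obsProb_cons, ← mul_sum, h, mul_one]
    exact (hp [] (by simp)).2

/-- The accumulated evidence `∏_{s < n} φ_s(z_s)`. -/
def evidence {Z : Type*} (φ : ℕ → Z → ℝ) (zs : List Z) (n : ℕ) : ℝ :=
  ∏ s ∈ range n, (zs[s]?).elim 1 (φ s)

theorem evidence_cons_succ {Z : Type*} (φ : ℕ → Z → ℝ) (a : Z) (zs : List Z) (n : ℕ) :
    evidence φ (a :: zs) (n + 1) = φ 0 a * evidence (fun s => φ (s + 1)) zs n := by
  simp [evidence, prod_range_succ', mul_comm]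

theorem evidence_hist {Z : Type*} {T : ℕ} {φ φ' : ℕ → Z → ℝ} (z : Fin T → Z) {t n : ℕ}
    (hn : n ≤ t) (h : ∀ s < n, φ s = φ' s) :
    evidence φ (hist z t) n = evidence φ' (List.ofFn z) n := by
  refine prod_congr rfl fun s hs => ?_
  have hs' := mem_range.1 hs
  rw [hist, List.getElem?_take_of_lt (hs'.trans_le hn), h s hs']

open Classical in
/-- A maximal inequality: the evidence for a false alternative rarely ever exceeds `a`. -/
theorem sum_obsProb_evidence_le {Z : Type*} [Fintype Z] {T : ℕ} {p : List Z → Z → ℝ}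
    {φ : ℕ → Z → ℝ} (hp : ∀ zs : List Z, zs.length < T → p zs ∈ stdSimplex ℝ Z)
    (hφ : ∀ s z, 0 < φ s z)
    (hpφ : ∀ zs : List Z, zs.length < T → ∑ z, p zs z * φ zs.length z ≤ 1)
    {a : ℝ} (ha : 0 < a) :
    ∑ z : Fin T → Z, (if ∃ n ≤ T, a < evidence φ (List.ofFn z) n then obsProb p z else 0)
      ≤ a⁻¹ := by
  have triv : a < 1 → ∑ z : Fin T → Z,
      (if ∃ n ≤ T, a < evidence φ (List.ofFn z) n then obsProb p z else 0) ≤ a⁻¹ := fun h1 =>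
    calc _ ≤ ∑ z : Fin T → Z, obsProb p z := sum_le_sum fun z _ => by
            split_ifs
            exacts [le_rfl, obsProb_nonneg hp z]
      _ = 1 := sum_obsProb hp
      _ ≤ a⁻¹ := (one_le_inv₀ ha).2 h1.le
  induction T generalizing p φ a with
  | zero =>
    by_cases h1 : a < 1
    · exact triv h1
    · simp [evidence, h1, ha.le]
  | succ T ih =>
    by_cases h1 : a < 1
    · exact triv h1
    clear triv
    rw [sum_fin_cons]
    -- Conditioning on the first observation `b` lowers the threshold to `a / φ 0 b`. A crossing at
    -- time 0 is impossible, since the empty product is 1 and `a ≥ 1`.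
    have hstep : ∀ (b : Z) (z : Fin T → Z),
        (∃ n ≤ T + 1, a < evidence φ (List.ofFn (Fin.cons b z : Fin (T + 1) → Z)) n) →
        ∃ n ≤ T, a / φ 0 b < evidence (fun s => φ (s + 1)) (List.ofFn z) n := by
      rintro b z ⟨n, hn, h⟩
      cases n with
      | zero => simp [evidence] at h; exact absurd h h1
      | succ n =>
        refine ⟨n, by omega, ?_⟩
        rw [div_lt_iff₀' (hφ 0 b), ← evidence_cons_succ]
        simpa [List.ofFn_succ] using h
    have hinner : ∀ b : Z, ∑ z : Fin T → Z,
        (if ∃ n ≤ T + 1, a < evidence φ (List.ofFn (Fin.cons b z : Fin (T + 1) → Z)) n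
          then obsProb p (Fin.cons b z : Fin (T + 1) → Z) else 0) ≤ p [] b * (a / φ 0 b)⁻¹ := by
      intro b
      have hp' : ∀ zs : List Z, zs.length < T → p (b :: zs) ∈ stdSimplex ℝ Z :=
        fun zs hzs => hp _ (by simpa using hzs)
      have hb : 0 ≤ p [] b := (hp [] (by simp)).1 b
      have hmain := ih (p := fun l => p (b :: l)) (φ := fun s => φ (s + 1)) hp'
        (fun s => hφ _) (fun zs hzs => by simpa using hpφ (b :: zs) (by simpa using hzs))
        (a := a / φ 0 b) (div_pos ha (hφ 0 b)) (fun h1 => by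
          calc _ ≤ ∑ z : Fin T → Z, obsProb (fun l => p (b :: l)) z := sum_le_sum fun z _ => by
                  split_ifs
                  exacts [le_rfl, obsProb_nonneg hp' z]
            _ = 1 := sum_obsProb hp'
            _ ≤ _ := (one_le_inv₀ (div_pos ha (hφ 0 b))).2 h1.le)
      refine le_trans ?_ (mul_le_mul_of_nonneg_left hmain hb)
      rw [mul_sum]
      refine sum_le_sum fun z _ => ?_
      have h0 := mul_nonneg hb (obsProb_nonneg hp' z)
      rw [obsProb_cons]
      by_cases hc : ∃ n ≤ T + 1, a < evidence φ (List.ofFn (Fin.cons b z : Fin (T + 1) → Z)) n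
      · rw [if_pos hc, if_pos (hstep b z hc)]
      · rw [if_neg hc]; split_ifs
        exacts [h0, by simp]
    calc _ ≤ ∑ b, p [] b * (a / φ 0 b)⁻¹ := sum_le_sum fun b _ => hinner b
      _ = (∑ b, p [] b * φ 0 b) * a⁻¹ := by
          rw [sum_mul]; exact sum_congr rfl fun b _ => by rw [inv_div]; ring
      _ ≤ 1 * a⁻¹ := mul_le_mul_of_nonneg_right (hpφ [] (by simp)) (inv_nonneg.2 ha.le)
      _ = a⁻¹ := one_mul _

/-! ### The potential argument for shrinking sets of experts. -/

open Classical in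
/-- Counting: shrinking expert sets `S t` keep a perfect expert `g`, and every expert still alive
has erred at most `m - 1` times. If each time in `E` more than half of the living experts err, then
`E` has few elements. -/
theorem card_filter_le_of_elimination {α : Type*} {G : Finset α} {T : ℕ} {S : ℕ → Finset α}
    {D : ℕ → α → Prop} {E : ℕ → Prop} {g : α} {m : ℝ} (hm : 1 ≤ m) (hSG : S 0 ⊆ G)
    (hS : Antitone S) (hg : ∀ t ≤ T, g ∈ S t) (hgD : ∀ t < T, ¬ D t g)
    (hN : ∀ t < T, ∀ i ∈ S t, (((range t).filter fun s => D s i).card : ℝ) + 1 ≤ m)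
    (hE : ∀ t < T, E t → (S t).card ≤ 2 * ((S t).filter (D t)).card) :
    (((range T).filter E).card : ℝ) ≤ 2 * m * Real.log G.card := by
  have hm0 : 0 < m := one_pos.trans_le hm
  let N : ℕ → α → ℝ := fun t i => ((range t).filter fun s => D s i).card
  -- The total remaining budget of the living experts. At a time in `E` it drops by at least `|S t|
  -- / 2 ≥ W t / (2 m)`, while `g` alone still contributes `m` at the end.
  let W : ℕ → ℝ := fun t => ∑ i ∈ S t, (m - N t i)
  have hNs : ∀ t i, N (t + 1) i = N t i + if D t i then 1 else 0 := fun t i => by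
    simp only [N, range_add_one, filter_insert]
    split_ifs <;> simp
  -- The spare unit in `hN` covers the error at time `t` itself, so all terms stay nonnegative and
  -- discarding experts only lowers `W`.
  have hNle : ∀ t < T, ∀ i ∈ S t, N (t + 1) i ≤ m := fun t ht i hi => by
    rw [hNs]
    have := hN t ht i hi
    split_ifs <;> linarith
  have hW : ∀ t ≤ T, W t ≤ m * G.card * Real.exp (-(((range t).filter E).card / (2 * m))) := by
    intro t ht
    induction t with
    | zero =>
      have : (S 0).card ≤ G.card := card_le_card hSG
      simp [W, N, mul_comm]
      gcongr
    | succ t ih =>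
      have ht' : t < T := ht
      have h1 : W (t + 1) ≤ W t - ((S t).filter (D t)).card := by
        calc W (t + 1) ≤ ∑ i ∈ S t, (m - N (t + 1) i) :=
              sum_le_sum_of_subset_of_nonneg (hS t.le_succ)
                fun i hi _ => sub_nonneg.2 (hNle t ht' i hi)
          _ = W t - ((S t).filter (D t)).card := by
              simp only [hNs, W, ← sub_sub, sum_sub_distrib]
              simp
      have h2 : W t ≤ m * (S t).card := by
        calc W t ≤ ∑ i ∈ S t, m := sum_le_sum fun i _ => by
              have : 0 ≤ N t i := Nat.cast_nonneg _
              linarith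
          _ = _ := by simp [mul_comm]
      have ih' := ih ht'.le
      rw [range_add_one, filter_insert]
      split_ifs with hEt
      · rw [card_insert_of_notMem (by simp)]
        have h3 : ((S t).card : ℝ) ≤ 2 * ((S t).filter (D t)).card := by
          exact_mod_cast hE t ht' hEt
        have h4 : W (t + 1) ≤ W t * (1 - 1 / (2 * m)) := by
          have : W t / (2 * m) ≤ ((S t).filter (D t)).card := by
            rw [div_le_iff₀ (by positivity)]; nlinarith
          have e : W t * (1 - 1 / (2 * m)) = W t - W t / (2 * m) := by ring
          linarith
        have h5 : 1 - 1 / (2 * m) ≤ Real.exp (-(1 / (2 * m))) := Real.one_sub_le_exp_neg _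
        have h6 : (0 : ℝ) ≤ 1 - 1 / (2 * m) := by
          rw [sub_nonneg, div_le_one (by positivity)]; linarith
        calc W (t + 1) ≤ W t * (1 - 1 / (2 * m)) := h4
          _ ≤ (m * G.card * Real.exp (-(((range t).filter E).card / (2 * m))))
                * Real.exp (-(1 / (2 * m))) := by gcongr
          _ = _ := by
              rw [mul_assoc, ← Real.exp_add]; push_cast; ring_nf
      · exact h1.trans ((sub_le_self _ (Nat.cast_nonneg _)).trans ih')
  have hN0 : N T g = 0 := by
    simp only [N, Nat.cast_eq_zero, card_eq_zero, filter_eq_empty_iff, mem_range]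
    exact fun s hs => hgD s hs
  have hge : m ≤ W T := by
    have hnn : ∀ i ∈ S T, 0 ≤ m - N T i := fun i hi => by
      cases T with
      | zero => simpa [N] using hm0.le
      | succ T => exact sub_nonneg.2 (hNle T T.lt_succ_self i (hS T.le_succ hi))
    calc m = m - N T g := by rw [hN0, sub_zero]
      _ ≤ W T := single_le_sum (f := fun i => m - N T i) hnn (hg T le_rfl)
  have hfin := hge.trans (hW T le_rfl)
  have hG : 0 < G.card := card_pos.2 ⟨g, hSG (hS (Nat.zero_le T) (hg T le_rfl))⟩
  have h7 : Real.exp (((range T).filter E).card / (2 * m)) ≤ G.card := by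
    rw [Real.exp_neg, ← div_eq_mul_inv, le_div_iff₀ (Real.exp_pos _), mul_comm,
      mul_comm m] at hfin
    exact le_of_mul_le_mul_right hfin hm0
  have h8 := (Real.le_log_iff_exp_le (by exact_mod_cast hG)).2 h7
  rw [div_le_iff₀ (by positivity)] at h8
  linarith

/-! ### Deterministic predictors. -/

/-- The predictor that always outputs `f`. -/
noncomputable def Predictor.deterministic {X Y Z : Type*} [Fintype Y]
    (f : List X → List Z → Y) : Predictor X Y Z where
  dist xs zs := by classical exact Pi.single (f xs zs) 1
  mem_stdSimplex xs zs := by classical exact single_mem_stdSimplex ℝ (f xs zs)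

theorem NoisyKernel.Admissible.mem_stdSimplex {X Y Z : Type*} [Fintype Z] {K : NoisyKernel X Y Z}
    {h : X → Y} {T : ℕ} {x : Fin T → X} {p : List Z → Z → ℝ} (hp : K.Admissible h x p)
    (zs : List Z) (hzs : zs.length < T) : p zs ∈ stdSimplex ℝ Z :=
  K.subset_stdSimplex _ _ (hp ⟨zs.length, hzs⟩ zs rfl)

open Classical in
theorem le_probRiskLE_deterministic {X Y Z : Type*} [Fintype Y] [Fintype Z] {T : ℕ}
    (f : List X → List Z → Y) (h : X → Y) {p : List Z → Z → ℝ}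
    (hp : ∀ zs : List Z, zs.length < T → p zs ∈ stdSimplex ℝ Z) (B : ℝ) (x : Fin T → X) :
    ∑ z : Fin T → Z, (if (risk h x (fun t => f (hist x (t + 1)) (hist z t)) : ℝ) ≤ B
      then obsProb p z else 0) ≤ probRiskLE (Predictor.deterministic f) h p B x := by
  refine sum_le_sum fun z _ => ?_
  have hnn : ∀ yhat : Fin T → Y, 0 ≤ if (risk h x yhat : ℝ) ≤ B
      then pathProb (Predictor.deterministic f) p x z yhat else 0 := fun yhat => by
    split_ifs
    · exact mul_nonneg (obsProb_nonneg hp z)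
        (prod_nonneg fun t _ => ((Predictor.deterministic f).mem_stdSimplex _ _).1 _)
    · exact le_rfl
  refine le_trans (le_of_eq ?_) (single_le_sum (fun yhat _ => hnn yhat)
    (mem_univ fun t : Fin T => f (hist x (t + 1)) (hist z t)))
  simp [pathProb, obsProb, Predictor.deterministic]

/-! ### Elimination by pairwise tests and the plurality vote. -/

/-- Pairwise tests lifted to functions of feature sequences. -/
def listTest {X Y Z : Type*} (φ : X → Y → Y → Z → ℝ) (i j : List X → Y) (xs : List X) : Z → ℝ :=
  xs.getLast?.elim 1 fun x => φ x (i xs) (j xs)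

theorem listTest_hist {X Y Z : Type*} (φ : X → Y → Y → Z → ℝ) (i j : List X → Y) {T : ℕ}
    (x : Fin T → X) (t : Fin T) :
    listTest φ i j (hist x (t + 1)) = φ (x t) (i (hist x (t + 1))) (j (hist x (t + 1))) := by
  have : (hist x (t + 1)).getLast? = some (x t) := by
    rw [List.getLast?_eq_getElem?, length_hist x t.2]
    simp [hist]
  simp [listTest, this]

theorem listTest_pos {X Y Z : Type*} {φ : X → Y → Y → Z → ℝ} (hφ : ∀ x y y' z, 0 < φ x y y' z)
    (i j : List X → Y) (xs : List X) (z : Z) : 0 < listTest φ i j xs z := by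
  unfold listTest
  cases xs.getLast? <;> simp [hφ]

open Classical in
/-- The functions in `G` that no other function in `G` has beaten in the pairwise tests. -/
noncomputable def survivors {X Y Z : Type*} (φ : X → Y → Y → Z → ℝ) (G : Finset (List X → Y))
    (A : ℝ) (xs : List X) (zs : List Z) : Finset (List X → Y) :=
  G.filter fun i => ∀ j ∈ G, ∀ n ≤ zs.length,
    evidence (fun s => listTest φ i j (xs.take (s + 1))) zs n ≤ A

/-- What the predictor computes from its truncated history equals evidence along the whole sequence,
so the analysis can work with the latter. -/
theorem evidence_survivors {X Y Z : Type*} (φ : X → Y → Y → Z → ℝ) (i j : List X → Y) {T : ℕ}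
    (x : Fin T → X) (z : Fin T → Z) {t n : ℕ} (hn : n ≤ t) :
    evidence (fun s => listTest φ i j ((hist x (t + 1)).take (s + 1))) (hist z t) n
      = evidence (fun s => listTest φ i j (hist x (s + 1))) (List.ofFn z) n :=
  evidence_hist z hn fun s hs => by
    rw [hist, List.take_take, min_eq_left (by omega), hist]

open Classical in
theorem exists_plurality {X Y Z : Type*} [Fintype Y] [Nonempty Y]
    (S : List X → List Z → Finset (List X → Y)) :
    ∃ f : List X → List Z → Y, ∀ xs zs y,
      ((S xs zs).filter fun i => i xs = y).card
        ≤ ((S xs zs).filter fun i => i xs = f xs zs).card := by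
  choose f hf using fun (xs : List X) (zs : List Z) =>
    Finite.exists_max fun y => ((S xs zs).filter fun i => i xs = y).card
  exact ⟨f, hf⟩

-- This converts evidence into disagreements: if both factors are at most `A` and `c > 1`, the
-- exponent is at most `2 log A / log c`.
open Classical in
theorem evidence_mul_evidence {X Y Z : Type*} {φ φ' : X → Y → Y → Z → ℝ} {c : ℝ}
    (hφφ' : ∀ x y y' z, φ x y y' z * φ' x y y' z = if y = y' then 1 else c)
    (i j : List X → Y) {T : ℕ} (x : Fin T → X) (z : Fin T → Z) {n : ℕ} (hn : n ≤ T) :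
    evidence (fun s => listTest φ i j (hist x (s + 1))) (List.ofFn z) n
      * evidence (fun s => listTest φ' i j (hist x (s + 1))) (List.ofFn z) n
      = c ^ ((range n).filter fun s => i (hist x (s + 1)) ≠ j (hist x (s + 1))).card := by
  rw [evidence, evidence, ← prod_mul_distrib, ← prod_const, prod_filter]
  refine prod_congr rfl fun s hs => ?_
  have hs' : s < T := (mem_range.1 hs).trans_le hn
  have h1 := listTest_hist φ i j x ⟨s, hs'⟩
  have h2 := listTest_hist φ' i j x ⟨s, hs'⟩
  simp only at h1 h2
  simp only [h1, h2, List.getElem?_ofFn, hs', dif_pos, Option.elim_some, hφφ', ite_not]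

/-- The event that no true hypothesis test misleads about `g` up to time `T`. -/
def Reliable {X Y Z : Type*} (φ φ' : X → Y → Y → Z → ℝ) (G : Finset (List X → Y)) (A : ℝ)
    (g : List X → Y) {T : ℕ} (x : Fin T → X) (z : Fin T → Z) : Prop :=
  ∀ j ∈ G, (∀ n ≤ T, evidence (fun s => listTest φ g j (hist x (s + 1))) (List.ofFn z) n ≤ A) ∧
    ∀ n ≤ T, evidence (fun s => listTest φ' j g (hist x (s + 1))) (List.ofFn z) n ≤ A

open Classical in
theorem Reliable.risk_le {X Y Z : Type*} {φ φ' : X → Y → Y → Z → ℝ} {G : Finset (List X → Y)}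
    {A γ : ℝ} {g : List X → Y} {T : ℕ} {x : Fin T → X} {z : Fin T → Z}
    (hz : Reliable φ φ' G A g x z) (hγ : 0 < γ) (hA : 1 ≤ A) (hφ' : ∀ x y y' z, 0 < φ' x y y' z)
    (hφφ' : ∀ x y y' z, φ x y y' z * φ' x y y' z = if y = y' then 1 else Real.exp (γ / 2))
    (hg : g ∈ G) {h : X → Y} (hgh : ∀ t : Fin T, h (x t) = g (hist x (t + 1)))
    {f : List X → List Z → Y}
    (hf : ∀ xs zs y, ((survivors φ G A xs zs).filter fun i => i xs = y).card
        ≤ ((survivors φ G A xs zs).filter fun i => i xs = f xs zs).card) :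
    (risk h x (fun t => f (hist x (t + 1)) (hist z t)) : ℝ)
      ≤ 2 * (4 * Real.log A / γ + 1) * Real.log G.card := by
  -- Asking for all `n ≤ t`, not just `n = t`, makes elimination permanent and `S` antitone.
  let S : ℕ → Finset (List X → Y) := fun t => G.filter fun i => ∀ j ∈ G, ∀ n ≤ t,
    evidence (fun s => listTest φ i j (hist x (s + 1))) (List.ofFn z) n ≤ A
  have hS : ∀ t ≤ T, survivors φ G A (hist x (t + 1)) (hist z t) = S t := fun t ht => by
    simp only [survivors, S, length_hist z ht]
    refine filter_congr fun i _ => forall₂_congr fun j _ => forall₂_congr fun n hn => ?_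
    rw [evidence_survivors φ i j x z hn]
  obtain ⟨D, hD⟩ : ∃ D : ℕ → (List X → Y) → Prop,
    ∀ t i, D t i ↔ i (hist x (t + 1)) ≠ g (hist x (t + 1)) := ⟨_, fun _ _ => Iff.rfl⟩
  obtain ⟨E, hE⟩ : ∃ E : ℕ → Prop,
    ∀ t, E t ↔ g (hist x (t + 1)) ≠ f (hist x (t + 1)) (hist z t) := ⟨_, fun _ => Iff.rfl⟩
  have hrisk : risk h x (fun t => f (hist x (t + 1)) (hist z t)) = ((range T).filter E).card := by
    rw [card_filter, ← Fin.sum_univ_eq_sum_range (fun t => if E t then 1 else 0)]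
    exact sum_congr rfl fun t _ => by simp only [hgh t, hE]
  rw [hrisk]
  have hlogA := Real.log_nonneg hA
  refine card_filter_le_of_elimination (S := S) (D := D) (E := E) (g := g)
    (m := 4 * Real.log A / γ + 1)
    (le_add_of_nonneg_left (by positivity)) (filter_subset _ _) (fun s t hst => ?_)
    (fun t ht => mem_filter.2 ⟨hg, fun j hj n hn => (hz j hj).1 n (hn.trans ht)⟩)
    (fun t _ => by simp [hD]) (fun t ht i hi => ?_) (fun t ht hEt => ?_)
  · exact monotone_filter_right _ fun i _ hi j hj n hn => hi j hj n (hn.trans hst)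
  · obtain ⟨hiG, hi⟩ := mem_filter.1 hi
    -- `h1` holds because `i` survives, `h2` because the event is reliable.
    have h1 := hi g hg t le_rfl
    have h2 := (hz i hiG).2 t ht.le
    have h3 := mul_le_mul h1 h2
      (prod_nonneg fun s _ => by
        cases (List.ofFn z)[s]? with
        | none => exact zero_le_one
        | some b => exact (listTest_pos hφ' _ _ _ _).le) (zero_le_one.trans hA)
    rw [evidence_mul_evidence hφφ' i g x z ht.le, ← Real.exp_nat_mul] at h3
    have h4 := Real.log_le_log (Real.exp_pos _) h3
    rw [Real.log_exp, Real.log_mul (by positivity) (by positivity)] at h4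
    have h5 : (((range t).filter fun s => D s i).card : ℝ) ≤ 4 * Real.log A / γ := by
      have e : ((range t).filter fun s => D s i).card
          = ((range t).filter fun s => i (hist x (s + 1)) ≠ g (hist x (s + 1))).card :=
        congrArg card (by ext s; simp [hD])
      rw [le_div_iff₀ hγ, e]
      linarith
    linarith
  · have h1 := hf (hist x (t + 1)) (hist z t) (g (hist x (t + 1)))
    rw [hS t ht.le] at h1
    have h2 : ((S t).filter fun i => i (hist x (t + 1)) = f (hist x (t + 1)) (hist z t)).card
        ≤ ((S t).filter (D t)).card :=
      card_le_card (monotone_filter_right _ fun i _ hi => by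
        simp only [hD, hi]; exact ((hE t).1 hEt).symm)
    have h3 := card_filter_add_card_filter_not (s := S t)
      (fun i => i (hist x (t + 1)) = g (hist x (t + 1)))
    have h4 : ((S t).filter (D t)).card
      = ((S t).filter fun i => ¬ i (hist x (t + 1)) = g (hist x (t + 1))).card :=
      congrArg card (by ext i; simp [hD])
    omega

-- A union bound over `2 |G|` tests. Each has conditional mean at most 1 because the observations
-- follow the label given by `g`, so each crosses `A` with probability at most `1 / A`.
open Classical in
theorem sum_obsProb_not_reliable_le {X Y Z : Type*} [Fintype Z] {K : NoisyKernel X Y Z}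
    {φ φ' : X → Y → Y → Z → ℝ} (hφ : ∀ x y y' z, 0 < φ x y y' z)
    (hφ' : ∀ x y y' z, 0 < φ' x y y' z)
    (hKφ : ∀ x y y', ∀ p ∈ K.dists x y, ∑ z, p z * φ x y y' z ≤ 1)
    (hKφ' : ∀ x y y', ∀ p ∈ K.dists x y', ∑ z, p z * φ' x y y' z ≤ 1)
    (G : Finset (List X → Y)) {A : ℝ} (hA : 0 < A) {g : List X → Y} {T : ℕ} {x : Fin T → X}
    {h : X → Y} (hgh : ∀ t : Fin T, h (x t) = g (hist x (t + 1))) {p : List Z → Z → ℝ}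
    (hp : K.Admissible h x p) :
    ∑ z : Fin T → Z, (if Reliable φ φ' G A g x z then 0 else obsProb p z)
      ≤ 2 * G.card / A := by
  have hmem := hp.mem_stdSimplex
  let V : (ℕ → Z → ℝ) → (Fin T → Z) → ℝ := fun ψ z =>
    if ∃ n ≤ T, A < evidence ψ (List.ofFn z) n then obsProb p z else 0
  have hV : ∀ ψ z, 0 ≤ V ψ z := fun ψ z => by
    simp only [V]; split_ifs
    exacts [obsProb_nonneg hmem z, le_rfl]
  let a : (List X → Y) → ℕ → Z → ℝ := fun j s => listTest φ g j (hist x (s + 1))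
  let b : (List X → Y) → ℕ → Z → ℝ := fun j s => listTest φ' j g (hist x (s + 1))
  have hle : ∀ z : Fin T → Z, (if Reliable φ φ' G A g x z then 0 else obsProb p z)
      ≤ ∑ j ∈ G, (V (a j) z + V (b j) z) := fun z => by
    split_ifs with hz
    · exact sum_nonneg fun j _ => add_nonneg (hV _ _) (hV _ _)
    · simp only [Reliable, not_forall, not_and_or, not_le] at hz
      obtain ⟨j, hj, hz⟩ := hz
      refine le_trans ?_ (single_le_sum (fun j _ => add_nonneg (hV (a j) z) (hV (b j) z)) hj)
      rcases hz with ⟨n, hn, hlt⟩ | ⟨n, hn, hlt⟩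
      · have : V (a j) z = obsProb p z := if_pos ⟨n, hn, hlt⟩
        linarith [hV (b j) z]
      · have : V (b j) z = obsProb p z := if_pos ⟨n, hn, hlt⟩
        linarith [hV (a j) z]
  have ha : ∀ j, ∑ z, V (a j) z ≤ A⁻¹ := fun j =>
    sum_obsProb_evidence_le hmem (fun s z => listTest_pos hφ _ _ _ _)
      (fun zs hzs => by
        have h1 := listTest_hist φ g j x ⟨zs.length, hzs⟩
        have h2 := hp ⟨zs.length, hzs⟩ zs rfl
        rw [hgh] at h2
        simp only at h1 ⊢
        rw [h1]
        exact hKφ _ _ _ _ h2) hA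
  have hb : ∀ j, ∑ z, V (b j) z ≤ A⁻¹ := fun j =>
    sum_obsProb_evidence_le hmem (fun s z => listTest_pos hφ' _ _ _ _)
      (fun zs hzs => by
        have h1 := listTest_hist φ' j g x ⟨zs.length, hzs⟩
        have h2 := hp ⟨zs.length, hzs⟩ zs rfl
        rw [hgh] at h2
        simp only at h1 ⊢
        rw [h1]
        exact hKφ' _ _ _ _ h2) hA
  calc _ ≤ ∑ z, ∑ j ∈ G, (V (a j) z + V (b j) z) := sum_le_sum fun z _ => hle z
    _ = ∑ j ∈ G, (∑ z, V (a j) z + ∑ z, V (b j) z) := by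
        rw [sum_comm]; simp only [sum_add_distrib]
    _ ≤ ∑ j ∈ G, (A⁻¹ + A⁻¹) := sum_le_sum fun j _ => add_le_add (ha j) (hb j)
    _ = 2 * G.card / A := by rw [sum_const, nsmul_eq_mul]; ring

/-! ### The guarantee for fixed features. -/

/-- The guarantee for a fixed feature sequence on which `h` agrees with some `g ∈ G`. -/
theorem exists_predictor_of_fixed_features {X Y Z : Type*} [Fintype Y] [Nonempty Y] [Fintype Z]
    {K : NoisyKernel X Y Z} {γ δ : ℝ} (hK : K.WellSeparated hellingerSq γ)
    (hc : ∀ x y, Convex ℝ (K.dists x y)) (hcl : ∀ x y, IsClosed (K.dists x y))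
    (hδ : 0 < δ) (hδ1 : δ < 1) (G : Finset (List X → Y)) :
    ∃ Φ : Predictor X Y Z, ∀ (T : ℕ) (x : Fin T → X) (h : X → Y), ∀ g ∈ G,
      (∀ t : Fin T, h (x t) = g (hist x (t + 1))) → ∀ p : List Z → Z → ℝ, K.Admissible h x p →
      1 - δ / 2 ≤ probRiskLE Φ h p (12 * (Real.log G.card * Real.log (4 * G.card / δ) / γ)) x := by
  classical
  have hγ := hK.1
  have hcard : ∀ g ∈ G, (1 : ℝ) ≤ G.card := fun g hg => by
    exact_mod_cast card_pos.2 ⟨g, hg⟩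
  have hA4 : ∀ g ∈ G, 4 ≤ 4 * G.card / δ := fun g hg => by
    rw [le_div_iff₀ hδ]; linarith [hcard g hg]
  -- The bound `γ ≤ 2` is needed to absorb the additive 1 in the budget. For `γ > 2`, since
  -- `hellingerSq` never exceeds 2, at most one label per feature has a nonempty set, and the
  -- predictor simply outputs it.
  by_cases hγ2 : γ ≤ 2
  · choose φ φ' hφ hφ' hKφ hKφ' hφφ' using fun x y y' => hK.exists_test hc hcl x y y'
    obtain ⟨f, hf⟩ := exists_plurality (survivors φ G (4 * G.card / δ))
    refine ⟨Predictor.deterministic f, fun T x h g hg hgh p hp => ?_⟩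
    refine le_trans ?_ (le_probRiskLE_deterministic f h hp.mem_stdSimplex _ x)
    have hA := hA4 g hg
    have hG := hcard g hg
    have hbad := sum_obsProb_not_reliable_le hφ hφ' hKφ hKφ' G (by linarith) hgh hp
    -- The threshold `4|G|/δ` is chosen for this identity.
    have heq : 2 * (G.card : ℝ) / (4 * G.card / δ) = δ / 2 := by
      field_simp
      norm_num
    rw [heq] at hbad
    rw [sub_le_iff_le_add, ← sum_obsProb hp.mem_stdSimplex]
    refine le_trans ?_ (add_le_add_right hbad _)
    rw [← sum_add_distrib]
    refine sum_le_sum fun z _ => ?_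
    have hnn := obsProb_nonneg hp.mem_stdSimplex z
    by_cases hz : Reliable φ φ' G (4 * G.card / δ) g x z
    · have hr := hz.risk_le hγ (by linarith) hφ' hφφ' hg hgh hf
      have hlog : 1 ≤ Real.log (4 * G.card / δ) :=
        (Real.le_log_iff_exp_le (by linarith)).2
          (by linarith [Real.exp_one_lt_d9])
      have hL := Real.log_nonneg hG
      -- The additive 1 becomes `2 log A / γ`, which gives the constant `12 = 2 * (4 + 2)`.
      have h1 : (1 : ℝ) ≤ 2 * Real.log (4 * G.card / δ) / γ := by
        rw [le_div_iff₀ hγ]; linarith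
      have hB : (risk h x (fun t => f (hist x (t + 1)) (hist z t)) : ℝ)
          ≤ 12 * (Real.log G.card * Real.log (4 * G.card / δ) / γ) :=
        calc _ ≤ _ := hr
          _ ≤ 2 * (4 * Real.log (4 * G.card / δ) / γ + 2 * Real.log (4 * G.card / δ) / γ)
                * Real.log G.card := by gcongr
          _ = _ := by ring
      rw [if_pos hB, if_pos hz, add_zero]
    · rw [if_neg hz]
      split_ifs <;> linarith
  · let f : List X → List Z → Y := fun xs _ => xs.getLast?.elim (Classical.arbitrary Y) fun x =>
      if hx : ∃ y, (K.dists x y).Nonempty then hx.choose else Classical.arbitrary Y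
    refine ⟨Predictor.deterministic f, fun T x h g hg hgh p hp => ?_⟩
    refine le_trans ?_ (le_probRiskLE_deterministic f h hp.mem_stdSimplex _ x)
    rcases isEmpty_or_nonempty (Fin T → Z) with hTZ | ⟨⟨z₀⟩⟩
    · have := sum_obsProb hp.mem_stdSimplex
      simp at this
    have hrisk : ∀ z : Fin T → Z, risk h x (fun t => f (hist x (t + 1)) (hist z t)) = 0 := by
      intro z
      refine sum_eq_zero fun t _ => if_neg (not_not.2 ?_)
      have hlast : (hist x (t + 1)).getLast? = some (x t) := by
        rw [List.getLast?_eq_getElem?, length_hist x t.2]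
        simp [hist]
      have hmem := hp t (hist z t) (length_hist z t.2.le)
      have hx : ∃ y, (K.dists (x t) y).Nonempty := ⟨_, _, hmem⟩
      simp only [f, hlast, Option.elim_some, dif_pos hx]
      by_contra hne
      obtain ⟨q, hq⟩ := hx.choose_spec
      have h1 := hK.le_of_mem hne hmem hq
      have h2 := hellingerSq_le_two (K.subset_stdSimplex _ _ hmem) (K.subset_stdSimplex _ _ hq)
      exact hγ2 (h1.trans h2)
    have hB : 0 ≤ 12 * (Real.log G.card * Real.log (4 * G.card / δ) / γ) := by
      have h1 := Real.log_nonneg (hcard g hg)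
      have h2 := Real.log_nonneg (show 1 ≤ 4 * G.card / δ by linarith [hA4 g hg])
      positivity
    simp only [hrisk, Nat.cast_zero, if_pos hB, sum_obsProb hp.mem_stdSimplex]
    linarith

/-! ### From fixed to random features. -/

/-- Neither `N` nor `F` is assumed measurable: `N` is replaced by its measurable hull and `F` is
bounded below by a constant off that hull. The two losses combine through `(1 - δ/2)² ≥ 1 - δ`. -/
theorem ofReal_le_lintegral_of_outer_le {Ω : Type*} [MeasurableSpace Ω] (μ : Measure Ω)
    [IsProbabilityMeasure μ] {N : Set Ω} {δ : ℝ} (hδ : 0 ≤ δ) (hδ1 : δ ≤ 1)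
    (hN : μ N ≤ ENNReal.ofReal (δ / 2)) {F : Ω → ENNReal}
    (hF : ∀ᵐ x ∂μ, x ∉ N → ENNReal.ofReal (1 - δ / 2) ≤ F x) :
    ENNReal.ofReal (1 - δ) ≤ ∫⁻ x, F x ∂μ := by
  have hmeas : MeasurableSet (toMeasurable μ N)ᶜ := (measurableSet_toMeasurable μ N).compl
  have hμ : ENNReal.ofReal (1 - δ / 2) ≤ μ (toMeasurable μ N)ᶜ := by
    rw [prob_compl_eq_one_sub (measurableSet_toMeasurable μ N), measure_toMeasurable,
      ENNReal.ofReal_sub _ (by linarith), ENNReal.ofReal_one]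
    exact tsub_le_tsub_left hN 1
  calc ENNReal.ofReal (1 - δ) ≤ ENNReal.ofReal ((1 - δ / 2) * (1 - δ / 2)) :=
        ENNReal.ofReal_le_ofReal (by nlinarith)
    _ = ENNReal.ofReal (1 - δ / 2) * ENNReal.ofReal (1 - δ / 2) :=
        ENNReal.ofReal_mul (by linarith)
    _ ≤ ENNReal.ofReal (1 - δ / 2) * μ (toMeasurable μ N)ᶜ := by gcongr
    _ = ∫⁻ x, (toMeasurable μ N)ᶜ.indicator (fun _ => ENNReal.ofReal (1 - δ / 2)) x ∂μ :=
        (lintegral_indicator_const hmeas _).symm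
    _ ≤ ∫⁻ x, F x ∂μ := lintegral_mono_ae <| hF.mono fun x hx => by
        by_cases hxN : x ∈ (toMeasurable μ N)ᶜ
        · rw [Set.indicator_of_mem hxN]
          exact hx fun hmem => hxN (subset_toMeasurable μ N hmem)
        · rw [Set.indicator_of_notMem hxN]
          exact zero_le

end NoisyOnline

theorem mainTheorem9 :
    ∃ C : ℝ, 0 < C ∧
      ∀ (X : Type*) [MeasurableSpace X]
        (Y : Type*) [Fintype Y] [Nontrivial Y]
        (Z : Type*) [Fintype Z] [Nontrivial Z]
        (T : ℕ) (H : Set (X → Y)) (P : Set (ProbabilityMeasure (Fin T → X)))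
        (K : NoisyOnline.NoisyKernel X Y Z) (γ δ : ℝ) (G : Finset (List X → Y)),
        (∀ x y, Convex ℝ (K.dists x y)) →
        (∀ x y, IsClosed (K.dists x y)) →
        K.WellSeparated NoisyOnline.hellingerSq γ →
        0 < δ →
        NoisyOnline.IsStochasticSequentialCover H P (G : Set (List X → Y)) (δ / 2) →
        ∃ Φ : NoisyOnline.Predictor X Y Z,
          ∀ ν ∈ P, ∀ h ∈ H, ∀ p : (Fin T → X) → List Z → (Z → ℝ),
            (∀ᵐ x ∂(ν : Measure (Fin T → X)), K.Admissible h x (p x)) →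
            ENNReal.ofReal (1 - δ) ≤
              ∫⁻ x, ENNReal.ofReal
                (NoisyOnline.probRiskLE Φ h (p x)
                  (C * (Real.log G.card * Real.log (4 * G.card / δ) / γ)) x)
                ∂(ν : Measure (Fin T → X)) := by
  refine ⟨12, by norm_num, ?_⟩
  intro X _ Y _ _ Z _ _ T H P K γ δ G hc hcl hK hδ hcov
  by_cases hδ1 : δ < 1
  swap
  · refine ⟨NoisyOnline.Predictor.deterministic fun _ _ => Classical.arbitrary Y,
      fun ν _ h _ p _ => ?_⟩
    rw [ENNReal.ofReal_of_nonpos (by linarith)]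
    exact zero_le
  obtain ⟨Φ, hΦ⟩ := NoisyOnline.exists_predictor_of_fixed_features hK hc hcl hδ hδ1 G
  refine ⟨Φ, fun ν hν h hh p hp => ?_⟩
  refine NoisyOnline.ofReal_le_lintegral_of_outer_le _ hδ.le hδ1.le (hcov ν hν) ?_
  filter_upwards [hp] with x hx hxN
  simp only [Finset.mem_coe] at hxN
  push Not at hxN
  obtain ⟨g, hg, hgh⟩ := hxN h hh
  exact ENNReal.ofReal_le_ofReal (hΦ T x h g hg hgh (p x) hx)
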